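/- Let $\mathbb{F}_q$ be a finite field, let $n,m\ge 0$ be integers, and let $\mathcal R$ be a probability distribution on $\{0,1,\dots,\min\{n,m\}\}$. Write $\mathbb{F}_q^{n\times m,s}$ for the set of $n\times m$ matrices of rank $s$ over $\mathbb{F}_q$, and $\mathrm{row}(M)$ for the row space of $M$. Let $\binom{a}{d}_q$ denote the number of $d$-dimensional subspaces of $\mathbb{F}_q^a$ (so it is $0$ if $d<0$ or $d>a$). Logarithms and entropies are taken to a fixed base $b>1$, and $0\log(x/0)=0$. For a $u$-dimensional subspace $U\subseteq\mathbb{F}_q^m$, let $f_0(u)$ be the number of $n\times m$ matrices with row space $U$. For an $n\times m$ matrix $M$ of rank $u$ and a $v$-dimensional subspace $V\subseteq\mathbb{F}_q^m$ with $\dim((\mathrm{row}(M)+V)/V)=h$, let $f_1(u,v,h;s)$ be the number of $B\in\mathbb{F}_q^{n\times m,s}$ with $\mathrm{row}(M+B)=V$. Then for fixed $q,n,m$ these numbers depend only on $u$, respectively on $u,v,h,s$ (if no such $U$, respectively $(M,V)$, exists, the value is set to $0$). Let $M$ be a fixed $n\times m$ matrix of rank $r$. Let $A$ be uniformly distributed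 on $\mathrm{GL}(n,q)$ and let $B$ be independent of $A$ and obtained by choosing a rank $s$ according to $\mathcal R$ and then a uniformly random matrix in $\mathbb{F}_q^{n\times m,s}$. Then the entropy $h_r=H(A(M+B))$ is $$h_r=\sum_{v=0}^{\min\{n,m\}}\ \sum_{h=0}^{r} q^{(v-r+h)h}\binom{m-r}{v-r+h}_q\binom{r}{r-h}_q\; p_{v,h}\,\log\!\left(\frac{f_0(v)}{p_{v,h}}\right),$$ where $$p_{v,h}=\sum_{s=h}^{\min\{n,m,v+h\}}\mathcal R(s)\,\frac{f_1(r,v,h;s)}{|\mathbb{F}_q^{n\times m,s}|}.$$ -/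

import Mathlib

open scoped BigOperators

namespace GammaChannel

/-- The row space of a matrix: the span of its rows. -/
def rowSpace {F : Type*} [Field F] {n m : ℕ} (M : Matrix (Fin n) (Fin m) F) :
    Submodule F (Fin m → F) :=
  Submodule.span F (Set.range M.row)

/-- The Gaussian binomial coefficient: the number of `d`-dimensional subspaces of the
`a`-dimensional space `F^a`. The lower index is an integer; there are no subspaces of negative
dimension, so the coefficient is `0` for `d < 0` (and likewise for `d > a`). -/
noncomputable def gaussBinom (F : Type*) [Field F] (a : ℕ) (d : ℤ) : ℕ :=
  Nat.card {W : Submodule F (Fin a → F) // (Module.finrank F W : ℤ) = d}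

/-- The number of `n × m` matrices over `F` of rank `s`. -/
noncomputable def numRank (F : Type*) [Field F] (n m s : ℕ) : ℕ :=
  Nat.card {B : Matrix (Fin n) (Fin m) F // B.rank = s}

/-- The dimension of `(U + V) / V`, that is, of the image of `U` in the quotient by `V`. -/
noncomputable def quotDim {F : Type*} [Field F] {m : ℕ} (U V : Submodule F (Fin m → F)) : ℕ :=
  Module.finrank F (U.map V.mkQ)

open Classical in
/-- `f₀(u)`: the number of `n × m` matrices whose row space is a given `u`-dimensional subspace
`U` of `F^m` (evaluated at a chosen `U`; `0` if there is no such `U`). -/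
noncomputable def f0 (F : Type*) [Field F] (n m u : ℕ) : ℕ :=
  if hU : ∃ U : Submodule F (Fin m → F), Module.finrank F U = u then
    Nat.card {M : Matrix (Fin n) (Fin m) F // rowSpace M = hU.choose}
  else 0

open Classical in
/-- `f₁(u, v, h; s)`: for a given matrix `M` of rank `u`, with row space `U`, and a given
`v`-dimensional subspace `V` with `dim ((U + V) / V) = h`, the number of `n × m` matrices `B` of
rank `s` such that `M + B` has row space `V` (evaluated at a chosen pair `(M, V)`; `0` if there
is no such pair). -/
noncomputable def f1 (F : Type*) [Field F] (n m u v h s : ℕ) : ℕ :=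
  if hp : ∃ p : Matrix (Fin n) (Fin m) F × Submodule F (Fin m → F),
      p.1.rank = u ∧ Module.finrank F p.2 = v ∧ quotDim (rowSpace p.1) p.2 = h then
    Nat.card {B : Matrix (Fin n) (Fin m) F //
      B.rank = s ∧ rowSpace (hp.choose.1 + B) = hp.choose.2}
  else 0

/-- There are `n × m` matrices of every rank `s ≤ min n m`. -/
theorem exists_rank_eq (F : Type*) [Field F] (n m : ℕ) (s : Fin (min n m + 1)) :
    ∃ M : Matrix (Fin n) (Fin m) F, M.rank = s := by
  have hn : (s : ℕ) ≤ n := by omega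
  have hm : (s : ℕ) ≤ m := by omega
  let E : Matrix (Fin n) (Fin s) F := Matrix.of fun i j => if i = Fin.castLE hn j then 1 else 0
  let E' : Matrix (Fin s) (Fin m) F := Matrix.of fun i j => if j = Fin.castLE hm i then 1 else 0
  have h1 : E.transpose * E = 1 := by
    ext i j
    simp [E, Matrix.mul_apply, Matrix.one_apply, Fin.castLE_inj, eq_comm]
  have h2 : E' * E'.transpose = 1 := by
    ext i j
    simp [E', Matrix.mul_apply, Matrix.one_apply, Fin.castLE_inj, eq_comm]
  have h3 : E.transpose * (E * E') * E'.transpose = 1 := by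
    rw [← Matrix.mul_assoc, h1, Matrix.one_mul, h2]
  refine ⟨E * E', le_antisymm ?_ ?_⟩
  · exact (Matrix.rank_mul_le_left _ _).trans (by simpa using E.rank_le_width)
  · calc (s : ℕ) = (E.transpose * (E * E') * E'.transpose).rank := by
          rw [h3, Matrix.rank_one, Fintype.card_fin]
      _ ≤ (E.transpose * (E * E')).rank := Matrix.rank_mul_le_left _ _
      _ ≤ (E * E').rank := Matrix.rank_mul_le_right _ _

/-- The uniform distribution on the `n × m` matrices of rank `s`. -/
noncomputable def uniformRank (F : Type*) [Field F] [Fintype F] [DecidableEq F] (n m : ℕ)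
    (s : Fin (min n m + 1)) : PMF (Matrix (Fin n) (Fin m) F) :=
  PMF.uniformOfFinset (Finset.univ.filter fun M : Matrix (Fin n) (Fin m) F => M.rank = s)
    (by
      obtain ⟨M, hM⟩ := exists_rank_eq F n m s
      exact ⟨M, by simpa using hM⟩)

/-- The Uniform Given Rank distribution with rank distribution `R`: choose a rank `s` according
to `R`, then a matrix of rank `s` uniformly. -/
noncomputable def ugr (F : Type*) [Field F] [Fintype F] [DecidableEq F] (n m : ℕ)
    (R : PMF (Fin (min n m + 1))) : PMF (Matrix (Fin n) (Fin m) F) :=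
  R.bind (uniformRank F n m)

/-- The law of the output `A (M + B)` of the Gamma channel with error rank distribution `R` on
the fixed input `M`: `A` is uniform in `GL(n, F)`, `B` is UGR with rank distribution `R`, and
`A` and `B` are independent. -/
noncomputable def outputLaw {F : Type*} [Field F] [Fintype F] [DecidableEq F] {n m : ℕ}
    (R : PMF (Fin (min n m + 1))) (M : Matrix (Fin n) (Fin m) F) :
    PMF (Matrix (Fin n) (Fin m) F) :=
  (PMF.uniformOfFintype (GL (Fin n) F)).bind fun A =>
    (ugr F n m R).map fun B => (A : Matrix (Fin n) (Fin n) F) * (M + B)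

/-- The Shannon entropy, with logarithms to base `b`, of a distribution on a finite set. -/
noncomputable def entropy {α : Type*} [Fintype α] (b : ℝ) (P : PMF α) : ℝ :=
  -∑ y, (P y).toReal * Real.logb b (P y).toReal

/-- `∑ R(s) f₁(r, v, h; s) / |F^{n × m, s}|` over the ranks `s` with `h ≤ s ≤ min {n, m, v + h}`. -/
noncomputable def rowProb (F : Type*) [Field F] (n m : ℕ) (R : PMF (Fin (min n m + 1)))
    (r v h : ℕ) : ℝ :=
  ∑ s : Fin (min n m + 1) with h ≤ s.val ∧ s.val ≤ v + h,
    (R s).toReal * ((f1 F n m r v h s : ℝ) / (numRank F n m s : ℝ))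

end GammaChannel

/-
Since `A` is uniform in `GL(n, F)`, the output `Y = A (M + B)` is uniform given its row space `V`,
so `H(Y) = ∑ V, P(V) log (f₀(dim V) / P(V))`, where `P` is the law of `row (M + B)`. The group
`GL(n, F) × GL(m, F)` preserves the law of `B`, and a pair of subspaces of `F^m` is determined up
to automorphism by its dimensions and that of its intersection; hence `P(V)` depends only on
`v = dim V` and on `h = dim ((row M + V) / V)`. It remains to count the `V` with given `v` and `h`.
Choosing a complement `C` of `S = row M`, a subspace of `C × S` is the same as a subspace `X` of
`C`, a subspace `W` of `S` and a linear map `X → S ⧸ W`; here `dim X = v - r + h`, `dim W = r - h`,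
and there are `q ^ ((v - r + h) h)` such maps.
-/

namespace GammaChannel

section LinearEquiv

open Module

variable {K E E' : Type*} [Field K] [AddCommGroup E] [Module K E] [AddCommGroup E'] [Module K E']

theorem exists_linearEquiv_map_eq [FiniteDimensional K E] [FiniteDimensional K E']
    (hE : finrank K E = finrank K E') {p : Submodule K E} {p' : Submodule K E'}
    (hp : finrank K p = finrank K p') :
    ∃ e : E ≃ₗ[K] E', p.map (e : E →ₗ[K] E') = p' := by
  let e₀ : E ≃ₗ[K] E' := LinearEquiv.ofFinrankEq E E' hE
  let f : p.map (e₀ : E →ₗ[K] E') ≃ₗ[K] p' :=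
    LinearEquiv.ofFinrankEq _ _ ((LinearEquiv.finrank_map_eq e₀ p).trans hp)
  obtain ⟨e₁, he₁⟩ := Submodule.exists_linearEquiv_restrict_eq f
  refine ⟨e₀ ≪≫ₗ e₁, Submodule.eq_of_le_of_finrank_eq ?_ (by rw [LinearEquiv.finrank_map_eq, hp])⟩
  rintro _ ⟨x, hx, rfl⟩
  have hfx : (f ⟨e₀ x, x, hx, rfl⟩ : E') = e₁ (e₀ x) := he₁ ⟨e₀ x, x, hx, rfl⟩
  exact hfx ▸ (f _).2

theorem map_eq_map_subtype_map_comap_subtype {p : Submodule K E} {p' : Submodule K E'}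
    {f : E →ₗ[K] E'} {g : p →ₗ[K] p'} (hfg : f ∘ₗ p.subtype = p'.subtype ∘ₗ g)
    {a : Submodule K E} (ha : a ≤ p) :
    a.map f = ((a.comap p.subtype).map g).map p'.subtype := by
  rw [← Submodule.map_comp, ← hfg, Submodule.map_comp, Submodule.map_comap_subtype,
    inf_eq_right.2 ha]

theorem exists_linearEquiv_map_eq_of_isCompl [FiniteDimensional K E] [FiniteDimensional K E']
    (hE : finrank K E = finrank K E') {p q a c : Submodule K E} {p' q' a' c' : Submodule K E'}
    (hpq : IsCompl p q) (hpq' : IsCompl p' q') (hp : finrank K p = finrank K p')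
    (hap : a ≤ p) (hap' : a' ≤ p') (ha : finrank K a = finrank K a')
    (hcq : c ≤ q) (hcq' : c' ≤ q') (hc : finrank K c = finrank K c') :
    ∃ e : E ≃ₗ[K] E', p.map (e : E →ₗ[K] E') = p' ∧ a.map (e : E →ₗ[K] E') = a' ∧
      c.map (e : E →ₗ[K] E') = c' := by
  have hq : finrank K q = finrank K q' := by
    have := Submodule.finrank_add_eq_of_isCompl hpq
    have := Submodule.finrank_add_eq_of_isCompl hpq'
    lia
  obtain ⟨e₁, he₁⟩ := exists_linearEquiv_map_eq hp (p := a.comap p.subtype)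
    (p' := a'.comap p'.subtype) (by rw [(Submodule.comapSubtypeEquivOfLe hap).finrank_eq,
      (Submodule.comapSubtypeEquivOfLe hap').finrank_eq, ha])
  obtain ⟨e₂, he₂⟩ := exists_linearEquiv_map_eq hq (p := c.comap q.subtype)
    (p' := c'.comap q'.subtype) (by rw [(Submodule.comapSubtypeEquivOfLe hcq).finrank_eq,
      (Submodule.comapSubtypeEquivOfLe hcq').finrank_eq, hc])
  let e : E ≃ₗ[K] E' := (p.prodEquivOfIsCompl q hpq).symm ≪≫ₗ e₁.prodCongr e₂ ≪≫ₗ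
    p'.prodEquivOfIsCompl q' hpq'
  have hep : (e : E →ₗ[K] E') ∘ₗ p.subtype = p'.subtype ∘ₗ (e₁ : p →ₗ[K] p') :=
    LinearMap.ext fun x => by simp [e]
  have heq : (e : E →ₗ[K] E') ∘ₗ q.subtype = q'.subtype ∘ₗ (e₂ : q →ₗ[K] q') :=
    LinearMap.ext fun x => by simp [e]
  refine ⟨e, ?_, ?_, ?_⟩
  · rw [map_eq_map_subtype_map_comap_subtype hep le_rfl, Submodule.comap_subtype_self,
      Submodule.map_top, LinearEquiv.range, Submodule.map_subtype_top]
  · rw [map_eq_map_subtype_map_comap_subtype hep hap, he₁, Submodule.map_comap_subtype,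
      inf_eq_right.2 hap']
  · rw [map_eq_map_subtype_map_comap_subtype heq hcq, he₂, Submodule.map_comap_subtype,
      inf_eq_right.2 hcq']

theorem exists_isCompl_and_inf_sup_eq (u v : Submodule K E) :
    ∃ c t : Submodule K E, IsCompl v t ∧ c ≤ t ∧ Disjoint (u ⊓ v) c ∧ u ⊓ v ⊔ c = u := by
  obtain ⟨c, hdisj, hsup⟩ :=
    IsModularLattice.exists_disjoint_and_sup_eq (inf_le_left : u ⊓ v ≤ u)
  have hcu : c ≤ u := hsup ▸ le_sup_right
  have hcv : Disjoint c v := by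
    rw [disjoint_iff_inf_le] at hdisj ⊢
    exact (le_inf (inf_le_inf_right v hcu) inf_le_left).trans hdisj
  obtain ⟨t, hct, ht⟩ := hcv.exists_isCompl
  exact ⟨c, t, ht.symm, hct, hdisj, hsup⟩

-- `u` is the sum of `u ⊓ v`, which lies in `v`, and of `c`, which lies in a complement of `v`.
theorem exists_linearEquiv_map_eq_and_map_eq [FiniteDimensional K E] [FiniteDimensional K E']
    (hE : finrank K E = finrank K E') {u v : Submodule K E} {u' v' : Submodule K E'}
    (hu : finrank K u = finrank K u') (hv : finrank K v = finrank K v')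
    (huv : finrank K (u ⊓ v : Submodule K E) = finrank K (u' ⊓ v' : Submodule K E')) :
    ∃ e : E ≃ₗ[K] E', u.map (e : E →ₗ[K] E') = u' ∧ v.map (e : E →ₗ[K] E') = v' := by
  obtain ⟨c, t, hvt, hct, hdisj, hsup⟩ := exists_isCompl_and_inf_sup_eq u v
  obtain ⟨c', t', hvt', hct', hdisj', hsup'⟩ := exists_isCompl_and_inf_sup_eq u' v'
  have hc : finrank K c = finrank K c' := by
    have h₁ := Submodule.finrank_sup_add_finrank_inf_eq (u ⊓ v) c
    have h₂ := Submodule.finrank_sup_add_finrank_inf_eq (u' ⊓ v') c'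
    rw [hsup, hdisj.eq_bot, finrank_bot] at h₁
    rw [hsup', hdisj'.eq_bot, finrank_bot] at h₂
    lia
  obtain ⟨e, hev, heuv, hec⟩ :=
    exists_linearEquiv_map_eq_of_isCompl hE hvt hvt' hv inf_le_right inf_le_right huv hct hct' hc
  exact ⟨e, by rw [← hsup, Submodule.map_sup, heuv, hec, hsup'], hev⟩

theorem exists_linearEquiv_comp_eq_of_surjective [FiniteDimensional K E] {f g : E →ₗ[K] E'}
    (hf : Function.Surjective f) (hg : Function.Surjective g) :
    ∃ e : E ≃ₗ[K] E, g ∘ₗ (e : E →ₗ[K] E) = f := by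
  have exists_equiv_prod {k : E →ₗ[K] E'} (hk : Function.Surjective k) :
      ∃ e : E ≃ₗ[K] E' × LinearMap.ker k, ∀ x, (e x).1 = k x := by
    obtain ⟨π, hπ⟩ := (LinearMap.ker k).subtype.exists_leftInverse_of_injective
      (LinearMap.ker k).ker_subtype
    have hπ' : ∀ x : LinearMap.ker k, π x = x := LinearMap.congr_fun hπ
    exact ⟨k.equivProdOfSurjectiveOfIsCompl π (LinearMap.range_eq_top.2 hk)
      (LinearMap.range_eq_top.2 fun x => ⟨x, hπ' x⟩) (LinearMap.isCompl_of_proj hπ'), fun _ => rfl⟩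
  have hker : finrank K (LinearMap.ker f) = finrank K (LinearMap.ker g) := by
    have h₁ := f.finrank_range_add_finrank_ker
    have h₂ := g.finrank_range_add_finrank_ker
    rw [LinearMap.range_eq_top.2 hf] at h₁
    rw [LinearMap.range_eq_top.2 hg] at h₂
    lia
  obtain ⟨e₁, he₁⟩ := exists_equiv_prod hf
  obtain ⟨e₂, he₂⟩ := exists_equiv_prod hg
  let e : E ≃ₗ[K] E := e₁ ≪≫ₗ
    (LinearEquiv.refl K E').prodCongr (LinearEquiv.ofFinrankEq _ _ hker) ≪≫ₗ e₂.symm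
  exact ⟨e, LinearMap.ext fun x => by simp [e, ← he₁, ← he₂]⟩

theorem exists_linearEquiv_comp_eq_of_range_eq [FiniteDimensional K E] {f g : E →ₗ[K] E'}
    (h : LinearMap.range f = LinearMap.range g) :
    ∃ e : E ≃ₗ[K] E, g ∘ₗ (e : E →ₗ[K] E) = f := by
  let f' : E →ₗ[K] LinearMap.range g := f.codRestrict _ fun x => h ▸ f.mem_range_self x
  have hf' : Function.Surjective f' := by
    rintro ⟨y, hy⟩
    obtain ⟨x, rfl⟩ := h ▸ hy
    exact ⟨x, rfl⟩
  obtain ⟨e, he⟩ := exists_linearEquiv_comp_eq_of_surjective hf' g.surjective_rangeRestrict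
  exact ⟨e, LinearMap.ext fun x => congrArg Subtype.val (LinearMap.congr_fun he x)⟩

end LinearEquiv

section CountingSubspaces

open Module

variable {K C U E : Type*} [Field K] [AddCommGroup C] [Module K C] [AddCommGroup U] [Module K U]
  [AddCommGroup E] [Module K E]

theorem finrank_map_add_finrank_inf_ker [FiniteDimensional K E] (f : E →ₗ[K] C)
    (p : Submodule K E) :
    finrank K (p.map f) + finrank K (p ⊓ LinearMap.ker f : Submodule K E) = finrank K p := by
  rw [← (f.domRestrict p).finrank_range_add_finrank_ker, LinearMap.range_domRestrict,
    LinearMap.ker_domRestrict, ← Submodule.map_comap_subtype, Submodule.finrank_map_subtype_eq]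

theorem finrank_map_fst_add_finrank_comap_inr [FiniteDimensional K C] [FiniteDimensional K U]
    (V : Submodule K (C × U)) :
    finrank K (V.map (LinearMap.fst K C U)) + finrank K (V.comap (LinearMap.inr K C U)) =
      finrank K V := by
  rw [← finrank_map_add_finrank_inf_ker (LinearMap.fst K C U) V, LinearMap.ker_fst,
    inf_comm, ← Submodule.map_comap_eq,
    (Submodule.equivMapOfInjective (LinearMap.inr K C U) LinearMap.inr_injective _).finrank_eq]

/-- The preimage in `C × U` of the graph of a partial linear map `φ : C →ₗ.[K] U ⧸ W`. Every
subspace of `C × U` arises uniquely in this way, `W` being its intersection with `U`. -/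
def graphPreimage (W : Submodule K U) (φ : C →ₗ.[K] U ⧸ W) : Submodule K (C × U) :=
  φ.graph.comap (LinearMap.id.prodMap W.mkQ)

theorem id_prodMap_mkQ_surjective (W : Submodule K U) :
    Function.Surjective ((LinearMap.id : C →ₗ[K] C).prodMap W.mkQ) :=
  Function.surjective_id.prodMap W.mkQ_surjective

theorem map_graphPreimage (W : Submodule K U) (φ : C →ₗ.[K] U ⧸ W) :
    (graphPreimage W φ).map (LinearMap.id.prodMap W.mkQ) = φ.graph :=
  Submodule.map_comap_eq_of_surjective (id_prodMap_mkQ_surjective W) _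

theorem graphPreimage_injective (W : Submodule K U) :
    Function.Injective (graphPreimage W : (C →ₗ.[K] U ⧸ W) → Submodule K (C × U)) :=
  fun _ _ h => LinearPMap.eq_of_eq_graph <|
    Submodule.comap_injective_of_surjective (id_prodMap_mkQ_surjective W) h

theorem map_fst_graphPreimage (W : Submodule K U) (φ : C →ₗ.[K] U ⧸ W) :
    (graphPreimage W φ).map (LinearMap.fst K C U) = φ.domain := by
  rw [← φ.graph_map_fst_eq_domain, ← map_graphPreimage, ← Submodule.map_comp]
  rfl

theorem comap_inr_graphPreimage (W : Submodule K U) (φ : C →ₗ.[K] U ⧸ W) :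
    (graphPreimage W φ).comap (LinearMap.inr K C U) = W := by
  ext u
  rw [← Submodule.Quotient.mk_eq_zero W]
  change ((0 : C), W.mkQ u) ∈ φ.graph ↔ W.mkQ u = 0
  exact ⟨fun h => φ.graph_fst_eq_zero_snd h rfl, fun h => h ▸ φ.graph.zero_mem⟩

theorem exists_graphPreimage_eq (V : Submodule K (C × U)) :
    ∃ φ, graphPreimage (V.comap (LinearMap.inr K C U)) φ = V := by
  refine ⟨(V.map (LinearMap.id.prodMap (Submodule.mkQ _))).toLinearPMap, ?_⟩
  rw [graphPreimage, Submodule.toLinearPMap_graph_eq, Submodule.comap_map_eq_self]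
  · rintro ⟨c, u⟩ h
    obtain ⟨rfl, hu⟩ := Prod.ext_iff.1 (LinearMap.mem_ker.1 h)
    exact (Submodule.Quotient.mk_eq_zero (V.comap (LinearMap.inr K C U))).1 hu
  · rintro _ ⟨⟨c, u⟩, h, rfl⟩ hc
    obtain rfl : c = 0 := hc
    exact (Submodule.Quotient.mk_eq_zero _).2 h

theorem card_submodule_map_fst_eq_and_comap_inr_eq (X : Submodule K C) (W : Submodule K U) :
    Nat.card {V : Submodule K (C × U) //
        V.map (LinearMap.fst K C U) = X ∧ V.comap (LinearMap.inr K C U) = W} =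
      Nat.card (X →ₗ[K] U ⧸ W) := by
  refine (Nat.card_eq_of_bijective (fun φ => ⟨graphPreimage W ⟨X, φ⟩, map_fst_graphPreimage W _,
    comap_inr_graphPreimage W _⟩) ⟨fun φ ψ h => ?_, ?_⟩).symm
  · have hφψ := graphPreimage_injective W (Subtype.ext_iff.1 h)
    exact eq_of_heq (LinearPMap.mk.inj hφψ).2
  · rintro ⟨V, rfl, rfl⟩
    obtain ⟨⟨X, φ⟩, h⟩ := exists_graphPreimage_eq V
    obtain rfl : X = V.map (LinearMap.fst K C U) :=
      (map_fst_graphPreimage _ ⟨X, φ⟩).symm.trans (congrArg _ h)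
    exact ⟨φ, Subtype.ext h⟩

theorem card_linearMap_quotient [Fintype K] [Finite C] [Finite U] (X : Submodule K C)
    (W : Submodule K U) :
    Nat.card (X →ₗ[K] U ⧸ W) = Fintype.card K ^ (finrank K X * (finrank K U - finrank K W)) := by
  rw [Module.natCard_eq_pow_finrank (K := K), Module.finrank_linearMap, Submodule.finrank_quotient,
    Nat.card_eq_fintype_card]

theorem card_subtype_comp_eq_mul {α β : Type*} [Finite α] [Finite β] (f : α → β) (q : β → Prop)
    {c : ℕ} (h : ∀ b, q b → Nat.card {a // f a = b} = c) :
    Nat.card {a // q (f a)} = Nat.card {b // q b} * c := by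
  have := Fintype.ofFinite {b // q b}
  rw [← Nat.card_congr (Equiv.sigmaSubtypeFiberEquivSubtype f fun _ => Iff.rfl), Nat.card_sigma,
    Finset.sum_congr rfl fun (b : {b // q b}) _ => h b b.2, Finset.sum_const, smul_eq_mul,
    Finset.card_univ, Nat.card_eq_fintype_card]

theorem card_submodule_prod [Fintype K] [Finite C] [Finite U] (k d : ℕ) :
    Nat.card {V : Submodule K (C × U) // finrank K (V.map (LinearMap.fst K C U)) = k ∧
        finrank K (V.comap (LinearMap.inr K C U)) = d} =
      Nat.card {X : Submodule K C // finrank K X = k} *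
        Nat.card {W : Submodule K U // finrank K W = d} *
          Fintype.card K ^ (k * (finrank K U - d)) := by
  have hfiber (Z : Submodule K C × Submodule K U) (hZ : finrank K Z.1 = k ∧ finrank K Z.2 = d) :
      Nat.card {V : Submodule K (C × U) //
          (V.map (LinearMap.fst K C U), V.comap (LinearMap.inr K C U)) = Z} =
        Fintype.card K ^ (k * (finrank K U - d)) := by
    simp only [Prod.ext_iff]
    rw [card_submodule_map_fst_eq_and_comap_inr_eq, card_linearMap_quotient, hZ.1, hZ.2]
  have hpairs := Nat.card_congr (Equiv.subtypeProdEquivProd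
    (p := fun X : Submodule K C => finrank K X = k) (q := fun W : Submodule K U => finrank K W = d))
  rw [← Nat.card_prod, ← hpairs]
  exact card_subtype_comp_eq_mul
    (fun V : Submodule K (C × U) => (V.map (LinearMap.fst K C U), V.comap (LinearMap.inr K C U)))
    (fun Z => finrank K Z.1 = k ∧ finrank K Z.2 = d) hfiber

theorem card_submodule_finrank_eq [FiniteDimensional K E] (d : ℕ) :
    Nat.card {X : Submodule K E // finrank K X = d} = gaussBinom K (finrank K E) d := by
  let e : E ≃ₗ[K] (Fin (finrank K E) → K) := LinearEquiv.ofFinrankEq _ _ (by simp)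
  refine Nat.card_congr ((Submodule.orderIsoMapComap e).toEquiv.subtypeEquiv fun X => ?_)
  rw [← Nat.cast_inj (R := ℤ)]
  exact Eq.congr_left (congrArg _ (LinearEquiv.finrank_map_eq e X).symm)

theorem comap_inr_map_prodEquivOfIsCompl_symm {T S : Submodule K E} (hTS : IsCompl T S)
    (V : Submodule K E) :
    (V.map ((T.prodEquivOfIsCompl S hTS).symm : E →ₗ[K] T × S)).comap (LinearMap.inr K T S) =
      V.comap S.subtype := by
  ext x
  rw [Submodule.mem_comap, Submodule.mem_map_equiv]
  simp

theorem card_submodule_finrank_inf_eq [Fintype K] [Finite E] (S : Submodule K E) (k d : ℕ) :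
    Nat.card {V : Submodule K E // finrank K V = k + d ∧
        finrank K (S ⊓ V : Submodule K E) = d} =
      gaussBinom K (finrank K E - finrank K S) k * gaussBinom K (finrank K S) d *
        Fintype.card K ^ (k * (finrank K S - d)) := by
  obtain ⟨T, hST⟩ := S.exists_isCompl
  have hdim := Submodule.finrank_add_eq_of_isCompl hST
  rw [← hdim, Nat.add_sub_cancel_left, ← card_submodule_finrank_eq, ← card_submodule_finrank_eq,
    ← card_submodule_prod]
  let e := T.prodEquivOfIsCompl S hST.symm
  refine Nat.card_congr ((Submodule.orderIsoMapComap e.symm).toEquiv.subtypeEquiv fun V => ?_)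
  let V' : Submodule K (T × S) := V.map (e.symm : E →ₗ[K] T × S)
  have hV : finrank K V' = finrank K V := LinearEquiv.finrank_map_eq e.symm V
  have hinf : finrank K (V'.comap (LinearMap.inr K T S)) =
      finrank K (S ⊓ V : Submodule K E) := by
    rw [comap_inr_map_prodEquivOfIsCompl_symm, ← Submodule.finrank_map_subtype_eq,
      Submodule.map_comap_subtype]
  have hfst := finrank_map_fst_add_finrank_comap_inr V'
  change _ ↔ finrank K (V'.map (LinearMap.fst K T S)) = k ∧
    finrank K (V'.comap (LinearMap.inr K T S)) = d
  lia

theorem quotDim_add_finrank_inf {m : ℕ} (S V : Submodule K (Fin m → K)) :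
    quotDim S V + finrank K (S ⊓ V : Submodule K (Fin m → K)) = finrank K S := by
  have := finrank_map_add_finrank_inf_ker V.mkQ S
  rwa [V.ker_mkQ] at this

theorem finrank_sup_eq_add_quotDim {m : ℕ} (S V : Submodule K (Fin m → K)) :
    finrank K (S ⊔ V : Submodule K (Fin m → K)) = finrank K V + quotDim S V := by
  have := Submodule.finrank_sup_add_finrank_inf_eq S V
  have := quotDim_add_finrank_inf S V
  lia

theorem gaussBinom_of_neg {a : ℕ} {d : ℤ} (hd : d < 0) : gaussBinom K a d = 0 :=
  Nat.card_eq_zero.2 (Or.inl ⟨fun W => by have := W.2; lia⟩)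

theorem card_submodule_quotDim_eq [Fintype K] {m : ℕ} (S : Submodule K (Fin m → K)) (v h : ℕ) :
    (Nat.card {V : Submodule K (Fin m → K) // finrank K V = v ∧ quotDim S V = h} : ℝ) =
      (Fintype.card K : ℝ) ^ (((v : ℤ) - finrank K S + h) * h) *
        (gaussBinom K (m - finrank K S) ((v : ℤ) - finrank K S + h) : ℝ) *
          (gaussBinom K (finrank K S) ((finrank K S : ℤ) - h) : ℝ) := by
  have hquot := quotDim_add_finrank_inf S
  by_cases hdim : h ≤ finrank K S ∧ finrank K S ≤ v + h
  · obtain ⟨d, hd⟩ := Nat.exists_eq_add_of_le hdim.1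
    obtain ⟨k, rfl⟩ : ∃ k, v = k + d := Nat.exists_eq_add_of_le' (by lia)
    have hiff (V : Submodule K (Fin m → K)) : (finrank K V = k + d ∧ quotDim S V = h) ↔
        (finrank K V = k + d ∧ finrank K (S ⊓ V : Submodule K (Fin m → K)) = d) := by
      have := hquot V
      lia
    have hk : ((k + d : ℕ) : ℤ) - finrank K S + h = k := by lia
    have hd' : (finrank K S : ℤ) - h = d := by lia
    rw [Nat.card_congr (Equiv.subtypeEquivRight hiff), card_submodule_finrank_inf_eq, hk, hd',
      finrank_fin_fun, hd, Nat.add_sub_cancel, ← Nat.cast_mul k h, zpow_natCast]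
    push_cast
    ring
  · have hempty : IsEmpty {V : Submodule K (Fin m → K) // finrank K V = v ∧ quotDim S V = h} := by
      refine ⟨fun V => hdim ?_⟩
      have := Submodule.finrank_mono (inf_le_right : S ⊓ V.1 ≤ V.1)
      have := hquot V
      lia
    rw [Nat.card_of_isEmpty]
    rcases not_and_or.1 hdim with hS | hv
    · simp [gaussBinom_of_neg (K := K) (d := (finrank K S : ℤ) - h) (by lia)]
    · simp [gaussBinom_of_neg (K := K) (d := (v : ℤ) - finrank K S + h) (by lia)]

end CountingSubspaces

section Matrices

variable {F : Type*} [Field F] {n m : ℕ}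

theorem rowSpace_eq_range (M : Matrix (Fin n) (Fin m) F) :
    rowSpace M = LinearMap.range M.vecMulLinear :=
  (range_vecMulLinear M).symm

theorem finrank_rowSpace (M : Matrix (Fin n) (Fin m) F) :
    Module.finrank F (rowSpace M) = M.rank :=
  M.rank_eq_finrank_span_row.symm

/-- Application of a linear automorphism `e` of `F^m` to each row of a matrix, that is, right
multiplication by the invertible matrix of `e`. -/
def mapRows (e : (Fin m → F) ≃ₗ[F] (Fin m → F)) :
    Matrix (Fin n) (Fin m) F ≃ₗ[F] Matrix (Fin n) (Fin m) F :=
  LinearEquiv.piCongrRight fun _ => e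

/-- Left multiplication by an invertible matrix, as a linear automorphism of the space of
`n × m` matrices. -/
def glMulLeft (P : GL (Fin n) F) : Matrix (Fin n) (Fin m) F ≃ₗ[F] Matrix (Fin n) (Fin m) F :=
  LinearEquiv.ofLinearMap (mulLeftLinearMap (Fin m) F P.val) (mulLeftLinearMap (Fin m) F P⁻¹.val)
    (by rw [← mulLeftLinearMap_mul, P.mul_inv, mulLeftLinearMap_one])
    (by rw [← mulLeftLinearMap_mul, P.inv_mul, mulLeftLinearMap_one])

theorem glMulLeft_apply (P : GL (Fin n) F) (M : Matrix (Fin n) (Fin m) F) :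
    glMulLeft P M = P.val * M := rfl

theorem glMulLeft_inv_apply_glMulLeft (P : GL (Fin n) F) (M : Matrix (Fin n) (Fin m) F) :
    glMulLeft P⁻¹ (glMulLeft P M) = M :=
  (glMulLeft P).symm_apply_apply M

theorem rowSpace_mapRows (e : (Fin m → F) ≃ₗ[F] (Fin m → F)) (M : Matrix (Fin n) (Fin m) F) :
    rowSpace (mapRows e M) = (rowSpace M).map (e : (Fin m → F) →ₗ[F] (Fin m → F)) := by
  rw [rowSpace, rowSpace, Submodule.map_span, ← Set.range_comp]
  rfl

theorem rank_mapRows (e : (Fin m → F) ≃ₗ[F] (Fin m → F)) (M : Matrix (Fin n) (Fin m) F) :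
    (mapRows e M).rank = M.rank := by
  rw [← finrank_rowSpace, ← finrank_rowSpace, rowSpace_mapRows, LinearEquiv.finrank_map_eq]

theorem rowSpace_mul_le (P : Matrix (Fin n) (Fin n) F) (M : Matrix (Fin n) (Fin m) F) :
    rowSpace (P * M) ≤ rowSpace M := by
  have h : (P * M).vecMulLinear = M.vecMulLinear ∘ₗ P.vecMulLinear :=
    LinearMap.ext fun x => (Matrix.vecMul_vecMul x P M).symm
  rw [rowSpace_eq_range, rowSpace_eq_range, h]
  exact LinearMap.range_comp_le_range _ _

theorem rowSpace_glMulLeft (P : GL (Fin n) F) (M : Matrix (Fin n) (Fin m) F) :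
    rowSpace (glMulLeft P M) = rowSpace M := by
  refine le_antisymm (rowSpace_mul_le P.val M) ?_
  conv_lhs => rw [← glMulLeft_inv_apply_glMulLeft P M]
  exact rowSpace_mul_le P⁻¹.val _

theorem rank_glMulLeft (P : GL (Fin n) F) (M : Matrix (Fin n) (Fin m) F) :
    (glMulLeft P M).rank = M.rank := by
  rw [← finrank_rowSpace, ← finrank_rowSpace, rowSpace_glMulLeft]

theorem exists_glMulLeft_eq {M N : Matrix (Fin n) (Fin m) F} (h : rowSpace M = rowSpace N) :
    ∃ P : GL (Fin n) F, glMulLeft P M = N := by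
  rw [rowSpace_eq_range, rowSpace_eq_range] at h
  obtain ⟨e, he⟩ := exists_linearEquiv_comp_eq_of_range_eq h.symm
  let P : Matrix (Fin n) (Fin n) F := LinearMap.toMatrixRight' e.toLinearMap
  have hP (x : Fin n → F) : Matrix.vecMul x P = e x :=
    LinearMap.congr_fun (LinearMap.toMatrixRight'.symm_apply_apply e.toLinearMap) x
  have hunit : IsUnit P := by
    rw [← Matrix.vecMul_injective_iff_isUnit, funext hP]
    exact e.injective
  refine ⟨hunit.unit, Matrix.vecMul_injective (funext fun x => ?_)⟩
  calc Matrix.vecMul x (P * M) = Matrix.vecMul (e x) M := by rw [← Matrix.vecMul_vecMul, hP]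
    _ = Matrix.vecMul x N := LinearMap.congr_fun he x

theorem card_rowSpace_eq_of_finrank_eq {U U' : Submodule F (Fin m → F)}
    (h : Module.finrank F U = Module.finrank F U') :
    Nat.card {M : Matrix (Fin n) (Fin m) F // rowSpace M = U} =
      Nat.card {M : Matrix (Fin n) (Fin m) F // rowSpace M = U'} := by
  obtain ⟨e, rfl⟩ := exists_linearEquiv_map_eq rfl h
  refine Nat.card_congr ((mapRows e).toEquiv.subtypeEquiv fun M => ?_)
  rw [LinearEquiv.coe_toEquiv, rowSpace_mapRows,
    (Submodule.map_injective_of_injective e.injective).eq_iff]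

theorem card_rowSpace_eq_f0 (U : Submodule F (Fin m → F)) :
    Nat.card {M : Matrix (Fin n) (Fin m) F // rowSpace M = U} = f0 F n m (Module.finrank F U) := by
  have hU : ∃ U' : Submodule F (Fin m → F), Module.finrank F U' = Module.finrank F U := ⟨U, rfl⟩
  rw [f0, dif_pos hU]
  exact card_rowSpace_eq_of_finrank_eq hU.choose_spec.symm

theorem finrank_le_of_f0_ne_zero {U : Submodule F (Fin m → F)}
    (h : f0 F n m (Module.finrank F U) ≠ 0) : Module.finrank F U ≤ min n m := by
  rw [← card_rowSpace_eq_f0] at h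
  obtain ⟨⟨M, rfl⟩⟩ := (Nat.card_ne_zero.1 h).1
  rw [finrank_rowSpace]
  exact le_min M.rank_le_height M.rank_le_width

theorem card_rank_eq_and_rowSpace_add_eq_mapRows (e : (Fin m → F) ≃ₗ[F] (Fin m → F))
    (M : Matrix (Fin n) (Fin m) F) (V : Submodule F (Fin m → F)) (s : ℕ) :
    Nat.card {B : Matrix (Fin n) (Fin m) F // B.rank = s ∧ rowSpace (mapRows e M + B) =
        V.map (e : (Fin m → F) →ₗ[F] (Fin m → F))} =
      Nat.card {B : Matrix (Fin n) (Fin m) F // B.rank = s ∧ rowSpace (M + B) = V} := by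
  refine (Nat.card_congr ((mapRows e).toEquiv.subtypeEquiv fun B => ?_)).symm
  rw [LinearEquiv.coe_toEquiv, ← map_add, rank_mapRows, rowSpace_mapRows,
    (Submodule.map_injective_of_injective e.injective).eq_iff]

theorem card_rank_eq_and_rowSpace_add_eq_glMulLeft (P : GL (Fin n) F)
    (M : Matrix (Fin n) (Fin m) F) (V : Submodule F (Fin m → F)) (s : ℕ) :
    Nat.card {B : Matrix (Fin n) (Fin m) F // B.rank = s ∧ rowSpace (glMulLeft P M + B) = V} =
      Nat.card {B : Matrix (Fin n) (Fin m) F // B.rank = s ∧ rowSpace (M + B) = V} := by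
  refine (Nat.card_congr ((glMulLeft P).toEquiv.subtypeEquiv fun B => ?_)).symm
  rw [LinearEquiv.coe_toEquiv, ← map_add, rank_glMulLeft, rowSpace_glMulLeft]

theorem card_rank_eq_and_rowSpace_add_eq_of_quotDim_eq {M M' : Matrix (Fin n) (Fin m) F}
    {V V' : Submodule F (Fin m → F)} (hM : M.rank = M'.rank)
    (hV : Module.finrank F V = Module.finrank F V')
    (h : quotDim (rowSpace M) V = quotDim (rowSpace M') V') (s : ℕ) :
    Nat.card {B : Matrix (Fin n) (Fin m) F // B.rank = s ∧ rowSpace (M + B) = V} =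
      Nat.card {B : Matrix (Fin n) (Fin m) F // B.rank = s ∧ rowSpace (M' + B) = V'} := by
  rw [← finrank_rowSpace, ← finrank_rowSpace] at hM
  have hinf : Module.finrank F (rowSpace M ⊓ V : Submodule F (Fin m → F)) =
      Module.finrank F (rowSpace M' ⊓ V' : Submodule F (Fin m → F)) := by
    have := quotDim_add_finrank_inf (rowSpace M) V
    have := quotDim_add_finrank_inf (rowSpace M') V'
    lia
  obtain ⟨e, he, rfl⟩ := exists_linearEquiv_map_eq_and_map_eq rfl hM hV hinf
  rw [← rowSpace_mapRows] at he
  obtain ⟨P, rfl⟩ := exists_glMulLeft_eq he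
  rw [card_rank_eq_and_rowSpace_add_eq_glMulLeft, card_rank_eq_and_rowSpace_add_eq_mapRows]

theorem card_rank_eq_and_rowSpace_add_eq_f1 (M : Matrix (Fin n) (Fin m) F)
    (V : Submodule F (Fin m → F)) (s : ℕ) :
    Nat.card {B : Matrix (Fin n) (Fin m) F // B.rank = s ∧ rowSpace (M + B) = V} =
      f1 F n m M.rank (Module.finrank F V) (quotDim (rowSpace M) V) s := by
  have hp : ∃ p : Matrix (Fin n) (Fin m) F × Submodule F (Fin m → F), p.1.rank = M.rank ∧
      Module.finrank F p.2 = Module.finrank F V ∧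
        quotDim (rowSpace p.1) p.2 = quotDim (rowSpace M) V := ⟨(M, V), rfl, rfl, rfl⟩
  rw [f1, dif_pos hp]
  obtain ⟨hrank, hdim, hquot⟩ := hp.choose_spec
  exact card_rank_eq_and_rowSpace_add_eq_of_quotDim_eq hrank.symm hdim.symm hquot.symm s

theorem rowSpace_add_le (A B : Matrix (Fin n) (Fin m) F) :
    rowSpace (A + B) ≤ rowSpace A ⊔ rowSpace B := by
  refine Submodule.span_le.2 ?_
  rintro _ ⟨i, rfl⟩
  exact Submodule.add_mem_sup (Submodule.subset_span ⟨i, rfl⟩) (Submodule.subset_span ⟨i, rfl⟩)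

theorem rowSpace_neg (A : Matrix (Fin n) (Fin m) F) : rowSpace (-A) = rowSpace A := by
  have h : (-A).vecMulLinear = -A.vecMulLinear := LinearMap.ext fun x => Matrix.vecMul_neg x A
  rw [rowSpace_eq_range, rowSpace_eq_range, h, LinearMap.range_neg]

theorem quotDim_le_rank (M B : Matrix (Fin n) (Fin m) F) :
    quotDim (rowSpace M) (rowSpace (M + B)) ≤ B.rank := by
  have hle : rowSpace M ⊔ rowSpace (M + B) ≤ rowSpace (M + B) ⊔ rowSpace B := by
    refine sup_le ?_ le_sup_left
    simpa [rowSpace_neg] using rowSpace_add_le (M + B) (-B)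
  have hmono := Submodule.finrank_mono hle
  have hadd := Submodule.finrank_add_le_finrank_add_finrank (rowSpace (M + B)) (rowSpace B)
  rw [finrank_sup_eq_add_quotDim] at hmono
  rw [finrank_rowSpace B] at hadd
  lia

theorem rank_le_finrank_add_quotDim (M B : Matrix (Fin n) (Fin m) F) :
    B.rank ≤ Module.finrank F (rowSpace (M + B)) + quotDim (rowSpace M) (rowSpace (M + B)) := by
  rw [← finrank_sup_eq_add_quotDim, ← finrank_rowSpace]
  refine Submodule.finrank_mono ?_
  simpa [rowSpace_neg] using rowSpace_add_le (-M) (M + B)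

theorem rank_bounds_of_f1_ne_zero {M : Matrix (Fin n) (Fin m) F} {V : Submodule F (Fin m → F)}
    {s : ℕ} (h : f1 F n m M.rank (Module.finrank F V) (quotDim (rowSpace M) V) s ≠ 0) :
    quotDim (rowSpace M) V ≤ s ∧ s ≤ Module.finrank F V + quotDim (rowSpace M) V := by
  rw [← card_rank_eq_and_rowSpace_add_eq_f1] at h
  obtain ⟨⟨B, rfl, rfl⟩⟩ := (Nat.card_ne_zero.1 h).1
  exact ⟨quotDim_le_rank M B, rank_le_finrank_add_quotDim M B⟩

end Matrices

section Distributions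

variable {α β : Type*}

theorem toReal_bind_apply [Fintype α] (P : PMF α) (f : α → PMF β) (c : β) :
    (P.bind f c).toReal = ∑ a, (P a).toReal * (f a c).toReal := by
  rw [PMF.bind_apply, tsum_fintype, ENNReal.toReal_sum fun a _ =>
    ENNReal.mul_ne_top (P.apply_ne_top a) ((f a).apply_ne_top c)]
  simp only [ENNReal.toReal_mul]

theorem toReal_map_apply [Fintype α] [DecidableEq β] (P : PMF α) (g : α → β) (c : β) :
    (P.map g c).toReal = ∑ a with g a = c, (P a).toReal := by
  have hpure (a : α) : (PMF.pure (g a) c).toReal = if g a = c then 1 else 0 := by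
    simp only [PMF.pure_apply, eq_comm (a := c), apply_ite ENNReal.toReal, ENNReal.toReal_one,
      ENNReal.toReal_zero]
  rw [PMF.map, toReal_bind_apply, Finset.sum_filter]
  simp only [Function.comp_apply, hpure, mul_ite, mul_one, mul_zero]

theorem toReal_map_apply_of_forall_eq [Finite α] (P : PMF α) (g : α → β) {c : β} {p : ℝ}
    (hP : ∀ a, g a = c → (P a).toReal = p) :
    (P.map g c).toReal = Nat.card {a // g a = c} * p := by
  classical
  have := Fintype.ofFinite α
  rw [toReal_map_apply, Finset.sum_congr rfl fun a ha => hP a (Finset.mem_filter.1 ha).2,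
    Finset.sum_const, nsmul_eq_mul, Nat.card_eq_fintype_card, Fintype.card_subtype]

theorem sum_toReal_mul_comp [Fintype α] [Fintype β] (P : PMF α) (g : α → β) (φ : β → ℝ) :
    ∑ a, (P a).toReal * φ (g a) = ∑ c, (P.map g c).toReal * φ c := by
  classical
  rw [← Finset.sum_fiberwise Finset.univ g]
  refine Finset.sum_congr rfl fun c _ => ?_
  rw [toReal_map_apply, Finset.sum_mul]
  exact Finset.sum_congr rfl fun a ha => by rw [(Finset.mem_filter.1 ha).2]

-- A point `a` of the fibre over `c` has mass `P (g ⁻¹ {c}) / |g ⁻¹ {c}|`.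
theorem entropy_eq_sum_fiber [Fintype α] [Fintype β] (b : ℝ) (P : PMF α) (g : α → β)
    (hP : ∀ a a', g a = g a' → P a = P a') :
    entropy b P = ∑ c, (P.map g c).toReal *
      Real.logb b ((Nat.card {a // g a = c} : ℝ) / (P.map g c).toReal) := by
  rw [entropy, ← Finset.sum_neg_distrib, ← sum_toReal_mul_comp P g fun c =>
    Real.logb b ((Nat.card {a // g a = c} : ℝ) / (P.map g c).toReal)]
  refine Finset.sum_congr rfl fun a _ => ?_
  have : Nonempty {a' // g a' = g a} := ⟨⟨a, rfl⟩⟩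
  have hcard : (Nat.card {a' // g a' = g a} : ℝ) ≠ 0 := Nat.cast_ne_zero.2 Nat.card_pos.ne'
  rw [toReal_map_apply_of_forall_eq P g fun a' h => congrArg ENNReal.toReal (hP a' a h),
    div_mul_cancel_left₀ hcard, Real.logb_inv, mul_neg]

theorem sum_comp_eq_sum_card_fiber [Fintype α] (g : α → β) (φ : β → ℝ) {t : Finset β}
    (ht : ∀ a, φ (g a) ≠ 0 → g a ∈ t) :
    ∑ a, φ (g a) = ∑ c ∈ t, Nat.card {a // g a = c} * φ c := by
  classical
  rw [← Finset.sum_filter_of_ne fun a _ => ht a, ← Finset.sum_fiberwise_eq_sum_filter]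
  refine Finset.sum_congr rfl fun c _ => ?_
  rw [Finset.sum_congr rfl fun a ha => congrArg φ (Finset.mem_filter.1 ha).2, Finset.sum_const,
    nsmul_eq_mul, Nat.card_eq_fintype_card, Fintype.card_subtype]

end Distributions

section OutputLaw

variable {F : Type*} [Field F] [Fintype F] [DecidableEq F] {n m : ℕ}

theorem outputLaw_glMulLeft (R : PMF (Fin (min n m + 1))) (M Y : Matrix (Fin n) (Fin m) F)
    (P : GL (Fin n) F) : outputLaw R M (glMulLeft P Y) = outputLaw R M Y := by
  have hinj (A : GL (Fin n) F) (Z : Matrix (Fin n) (Fin m) F) :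
      glMulLeft P Y = (P * A).val * Z ↔ Y = A.val * Z := by
    rw [Units.val_mul, Matrix.mul_assoc, ← glMulLeft_apply, (glMulLeft P).injective.eq_iff]
  rw [outputLaw, PMF.bind_apply, PMF.bind_apply, ← (Equiv.mulLeft P).tsum_eq]
  refine tsum_congr fun A => ?_
  simp only [Equiv.coe_mulLeft, PMF.uniformOfFintype_apply, PMF.map_apply, hinj]
  congr!

theorem outputLaw_eq_of_rowSpace_eq (R : PMF (Fin (min n m + 1))) (M : Matrix (Fin n) (Fin m) F)
    {Y Z : Matrix (Fin n) (Fin m) F} (h : rowSpace Y = rowSpace Z) :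
    outputLaw R M Y = outputLaw R M Z := by
  obtain ⟨P, rfl⟩ := exists_glMulLeft_eq h
  exact (outputLaw_glMulLeft R M Y P).symm

theorem outputLaw_map_rowSpace (R : PMF (Fin (min n m + 1))) (M : Matrix (Fin n) (Fin m) F) :
    (outputLaw R M).map rowSpace = (ugr F n m R).map fun B => rowSpace (M + B) := by
  rw [outputLaw, PMF.map_bind]
  simp only [PMF.map_comp, Function.comp_def, ← glMulLeft_apply, rowSpace_glMulLeft]
  exact PMF.bind_const _ _

theorem toReal_uniformRank_apply (s : Fin (min n m + 1)) (B : Matrix (Fin n) (Fin m) F) :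
    (uniformRank F n m s B).toReal = if B.rank = s then (numRank F n m s : ℝ)⁻¹ else 0 := by
  rw [numRank, Nat.card_eq_fintype_card, Fintype.card_subtype]
  simp only [uniformRank, PMF.uniformOfFinset_apply, Finset.mem_filter, Finset.mem_univ, true_and,
    apply_ite ENNReal.toReal, ENNReal.toReal_inv, ENNReal.toReal_natCast, ENNReal.toReal_zero]

theorem toReal_uniformRank_map_rowSpace_apply (M : Matrix (Fin n) (Fin m) F)
    (s : Fin (min n m + 1)) (V : Submodule F (Fin m → F)) :
    ((uniformRank F n m s).map (fun B => rowSpace (M + B)) V).toReal =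
      (f1 F n m M.rank (Module.finrank F V) (quotDim (rowSpace M) V) s : ℝ) /
        (numRank F n m s : ℝ) := by
  classical
  rw [toReal_map_apply, ← card_rank_eq_and_rowSpace_add_eq_f1]
  simp only [toReal_uniformRank_apply]
  rw [← Finset.sum_filter, Finset.filter_filter, Finset.sum_const, nsmul_eq_mul, div_eq_mul_inv,
    Nat.card_eq_fintype_card, Fintype.card_subtype]
  simp only [and_comm]

theorem toReal_outputLaw_map_rowSpace_apply (R : PMF (Fin (min n m + 1)))
    (M : Matrix (Fin n) (Fin m) F) (V : Submodule F (Fin m → F)) :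
    ((outputLaw R M).map rowSpace V).toReal =
      rowProb F n m R M.rank (Module.finrank F V) (quotDim (rowSpace M) V) := by
  rw [outputLaw_map_rowSpace, ugr, PMF.map_bind, toReal_bind_apply, rowProb,
    Finset.sum_filter_of_ne fun s _ hs => ?_]
  · simp only [toReal_uniformRank_map_rowSpace_apply]
  · refine rank_bounds_of_f1_ne_zero fun h => hs ?_
    rw [h, Nat.cast_zero, zero_div, mul_zero]

theorem entropy_outputLaw_eq_sum_submodule [Fintype (Submodule F (Fin m → F))]
    (R : PMF (Fin (min n m + 1))) (b : ℝ) (M : Matrix (Fin n) (Fin m) F) :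
    entropy b (outputLaw R M) = ∑ V : Submodule F (Fin m → F),
      rowProb F n m R M.rank (Module.finrank F V) (quotDim (rowSpace M) V) *
        Real.logb b ((f0 F n m (Module.finrank F V) : ℝ) /
          rowProb F n m R M.rank (Module.finrank F V) (quotDim (rowSpace M) V)) := by
  rw [entropy_eq_sum_fiber b _ rowSpace fun _ _ => outputLaw_eq_of_rowSpace_eq R M]
  simp only [toReal_outputLaw_map_rowSpace_apply, card_rowSpace_eq_f0]

theorem entropy_outputLaw_eq_sum_card (R : PMF (Fin (min n m + 1))) (b : ℝ)
    (M : Matrix (Fin n) (Fin m) F) :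
    entropy b (outputLaw R M) =
      ∑ v ∈ Finset.range (min n m + 1), ∑ h ∈ Finset.range (M.rank + 1),
        (Nat.card {V : Submodule F (Fin m → F) //
          Module.finrank F V = v ∧ quotDim (rowSpace M) V = h} : ℝ) *
          (rowProb F n m R M.rank v h *
            Real.logb b ((f0 F n m v : ℝ) / rowProb F n m R M.rank v h)) := by
  have := Fintype.ofFinite (Submodule F (Fin m → F))
  let dims (V : Submodule F (Fin m → F)) : ℕ × ℕ := (Module.finrank F V, quotDim (rowSpace M) V)
  let φ (c : ℕ × ℕ) : ℝ := rowProb F n m R M.rank c.1 c.2 *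
    Real.logb b ((f0 F n m c.1 : ℝ) / rowProb F n m R M.rank c.1 c.2)
  have hsupp (V : Submodule F (Fin m → F)) (hV : φ (dims V) ≠ 0) :
      dims V ∈ Finset.range (min n m + 1) ×ˢ Finset.range (M.rank + 1) := by
    have hf0 : f0 F n m (Module.finrank F V) ≠ 0 := fun h => hV (by simp [φ, dims, h])
    have hquot := quotDim_add_finrank_inf (rowSpace M) V
    rw [finrank_rowSpace] at hquot
    exact Finset.mem_product.2 ⟨Finset.mem_range_succ_iff.2 (finrank_le_of_f0_ne_zero hf0),
      Finset.mem_range_succ_iff.2 (hquot ▸ Nat.le_add_right _ _)⟩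
  rw [entropy_outputLaw_eq_sum_submodule]
  refine (sum_comp_eq_sum_card_fiber dims φ hsupp).trans ?_
  simp only [Finset.sum_product, dims, φ, Prod.mk.injEq]

end OutputLaw

end GammaChannel

theorem theorem6p1 {F : Type*} [Field F] [Fintype F] [DecidableEq F] (n m : ℕ)
    (R : PMF (Fin (min n m + 1))) (b : ℝ) (hb : 1 < b)
    (r : ℕ) (M : Matrix (Fin n) (Fin m) F) (hM : M.rank = r) :
    -- `f₀` does not depend on the choice of the subspace
    (∀ U : Submodule F (Fin m → F),
      Nat.card {M' : Matrix (Fin n) (Fin m) F // GammaChannel.rowSpace M' = U} =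
        GammaChannel.f0 F n m (Module.finrank F U)) ∧
    -- `f₁` does not depend on the choice of the matrix and of the subspace
    (∀ (M' : Matrix (Fin n) (Fin m) F) (V : Submodule F (Fin m → F)) (s : ℕ),
      Nat.card {B : Matrix (Fin n) (Fin m) F //
          B.rank = s ∧ GammaChannel.rowSpace (M' + B) = V} =
        GammaChannel.f1 F n m M'.rank (Module.finrank F V)
          (GammaChannel.quotDim (GammaChannel.rowSpace M') V) s) ∧
    -- the value of `h_r`
    GammaChannel.entropy b (GammaChannel.outputLaw R M) =
      ∑ v ∈ Finset.range (min n m + 1), ∑ h ∈ Finset.range (r + 1),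
        (Fintype.card F : ℝ) ^ (((v : ℤ) - r + h) * h) *
          (GammaChannel.gaussBinom F (m - r) ((v : ℤ) - r + h) : ℝ) *
          (GammaChannel.gaussBinom F r ((r : ℤ) - h) : ℝ) *
          (GammaChannel.rowProb F n m R r v h *
            Real.logb b ((GammaChannel.f0 F n m v : ℝ) /
              GammaChannel.rowProb F n m R r v h)) := by
  subst hM
  refine ⟨GammaChannel.card_rowSpace_eq_f0, GammaChannel.card_rank_eq_and_rowSpace_add_eq_f1, ?_⟩
  simp only [GammaChannel.entropy_outputLaw_eq_sum_card,
    GammaChannel.card_submodule_quotDim_eq, GammaChannel.finrank_rowSpace]
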